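/- All graphs are finite, simple and have at least one vertex. A *longest path* of a graph $G$ is a path of $G$ with the maximum number of edges among all paths of $G$. A *Gallai set* of $G$ is a set of vertices that meets every longest path of $G$; a *Gallai vertex* is a vertex $v$ such that $\{v\}$ is a Gallai set, i.e. $v$ lies on every longest path of $G$. Let $\mathrm{lpt}(G)$ be the minimum size of a Gallai set of $G$. A family of graphs is a *Gallai family* if $\mathrm{lpt}(G)=1$ for every connected graph $G$ in it. A graph $H$ is a *fixer* if the class of all graphs with no induced subgraph isomorphic to $H$ is a Gallai family. Let $5P_1$ be the disjoint union of five copies of the one-vertex path $P_1$, and let $\alpha(G)$ be the independence number of $G$. **Theorem.** Every connected graph $G$ with $\alpha(G)\le 4$ has a Gallai vertex. Equivalently, $5P_1$ is a fixer. -/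

import Mathlib

universe u

namespace GallaiPaths

open SimpleGraph

/-- A walk `p` of `G` is a longest path of `G`: it is a path, and no path of `G` (with any
endpoints) has more edges. -/
def IsLongestPath {V : Type*} (G : SimpleGraph V) {a b : V} (p : G.Walk a b) : Prop :=
  p.IsPath ∧ ∀ (c d : V) (q : G.Walk c d), q.IsPath → q.length ≤ p.length

/-- A Gallai set (longest path transversal): a set of vertices that intersects every longest
path of `G`. -/
def IsGallaiSet {V : Type*} (G : SimpleGraph V) (S : Set V) : Prop :=
  ∀ (a b : V) (p : G.Walk a b), IsLongestPath G p → ∃ w ∈ S, w ∈ p.support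

/-- A Gallai vertex: a vertex `v` such that `{v}` is a Gallai set. -/
def IsGallaiVertex {V : Type*} (G : SimpleGraph V) (v : V) : Prop :=
  IsGallaiSet G {v}

/-- The Gallai number `lpt(G)` of a finite graph: the minimum size of a Gallai set
(the set of all vertices of a finite nonempty graph is one, so the minimum exists). -/
noncomputable def lpt {V : Type*} (G : SimpleGraph V) : ℕ :=
  sInf {n : ℕ | ∃ S : Finset V, S.card = n ∧ IsGallaiSet G (S : Set V)}

/-- A family of graphs is a Gallai family if `lpt(G) = 1` for every connected (finite) graph
`G` in it. -/
def IsGallaiFamily (F : (V : Type u) → SimpleGraph V → Prop) : Prop :=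
  ∀ (V : Type u) [Finite V] (G : SimpleGraph V), F V G → G.Connected → lpt G = 1

/-- `Free(H)`: the class of graphs that have no induced subgraph isomorphic to `H`. -/
def FreeClass {W : Type*} (H : SimpleGraph W) (V : Type u) (G : SimpleGraph V) : Prop :=
  ¬ H.IsIndContained G

/-- `H` is a fixer if `Free(H)` is a Gallai family. -/
def IsFixer {W : Type*} (H : SimpleGraph W) : Prop :=
  IsGallaiFamily.{u} (FreeClass.{u} H)

/-- `kH`: the disjoint union of `k` copies of the graph `H`. -/
def copies {W : Type*} (k : ℕ) (H : SimpleGraph W) : SimpleGraph (Fin k × W) where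
  Adj x y := x.1 = y.1 ∧ H.Adj x.2 y.2
  symm := ⟨fun _ _ h => ⟨h.1.symm, h.2.symm⟩⟩
  loopless := ⟨fun _ h => H.irrefl h.2⟩

end GallaiPaths

/-! Suppose no vertex is on every longest path. Over all longest paths $P$, take a component $F$ of
$G-P$ of maximum size, an attachment $a\in P$ of $F$, a longest path $Q$ avoiding $a$, and the
component $F'$ of $G-Q$ containing $a$. As $|F'|\le|F|$, $F'$ cannot swallow $F\cup\{a\}$, so some
$u\in F$ is an attachment of $F'$ on $Q$. The successors on $P$ of the attachments of $F$, the head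
of $P$ and a vertex of $F$ are independent. So $\alpha\le4$ allows at most two attachments
(`not_three_attachments`), and two of them force $F$ to be a clique (`adj_of_two_attachments`). In
that case both sides of $a$ on $P$ have at least $|F|$ vertices (`card_le_length`), too many for
$F'$, and each side yields one more attachment of $F'$: three with $u$. If instead $a$ is the only
attachment of $F$, then $Q$ meets $F$, leaves it (`not_subset`), and must pass through $a$. -/

namespace GallaiPaths

open SimpleGraph

/-! ### Longest paths as vertex lists, and rerouting through a fragment. -/

section ListPaths

variable {V : Type*} {G : SimpleGraph V}

/-- The vertex list `P` of a longest path of `G`. -/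
structure IsLongestList (G : SimpleGraph V) (P : List V) : Prop where
  chain : P.IsChain G.Adj
  nodup : P.Nodup
  length_le : ∀ l : List V, l.IsChain G.Adj → l.Nodup → l.length ≤ P.length

/-- `F` is (the vertex set of) a connected component of `G - P`. -/
structure IsFragment (G : SimpleGraph V) (P : List V) (F : Finset V) : Prop where
  disjoint : ∀ x ∈ F, x ∉ P
  closed : ∀ x ∈ F, ∀ y, G.Adj x y → y ∉ P → y ∈ F
  connected : ∀ x ∈ F, ∀ y ∈ F, ∃ L : List V, L.IsChain G.Adj ∧ L.Nodup ∧
    L.head? = some x ∧ L.getLast? = some y ∧ ∀ z ∈ L, z ∈ F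

lemma isChain_adj_reverse {l : List V} : l.reverse.IsChain G.Adj ↔ l.IsChain G.Adj := by
  rw [List.isChain_reverse]
  simp only [G.adj_comm]

lemma IsLongestList.reverse {P : List V} (h : IsLongestList G P) :
    IsLongestList G P.reverse :=
  ⟨isChain_adj_reverse.2 h.chain, List.nodup_reverse.2 h.nodup, by simpa using h.length_le⟩

lemma IsFragment.reverse {P : List V} {F : Finset V} (h : IsFragment G P F) :
    IsFragment G P.reverse F :=
  ⟨by simpa using h.disjoint, by simpa using h.closed, h.connected⟩

/-- A chain that contains both elements of `S` and elements outside `S` has an adjacent pair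
crossing the boundary of `S`. -/
lemma exists_adj_crossing {l : List V} (hl : l.IsChain G.Adj) (S : Set V) {x y : V}
    (hx : x ∈ l) (hy : y ∈ l) (hxS : x ∈ S) (hyS : y ∉ S) :
    ∃ u ∈ l, ∃ v ∈ l, u ∈ S ∧ v ∉ S ∧ G.Adj u v := by
  by_contra! hcon
  have key : ∀ l : List V, l.IsChain G.Adj →
      (∀ u ∈ l, ∀ v ∈ l, u ∈ S → v ∉ S → ¬ G.Adj u v) →
      (∀ u ∈ l, u ∈ S) ∨ (∀ u ∈ l, u ∉ S) := by
    intro l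
    induction l with
    | nil => simp
    | cons a t ih =>
      intro hc h
      cases t with
      | nil => by_cases a ∈ S <;> simp [*]
      | cons b t =>
        rw [List.isChain_cons_cons] at hc
        have h1 := h a (by simp) b (by simp)
        have h2 := h b (by simp) a (by simp)
        have := ih hc.2 (fun u hu v hv => h u (by simp [hu]) v (by simp [hv]))
        have h3 := hc.1
        have h4 := hc.1.symm
        by_cases haS : a ∈ S <;> by_cases hbS : b ∈ S <;> grind
  rcases key l hl hcon with h | h
  · exact hyS (h y hy)
  · exact h x hx hxS

variable {P : List V} {F : Finset V}

lemma IsLongestList.ne_nil (hP : IsLongestList G P) (v : V) : P ≠ [] := by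
  rintro rfl
  simpa using hP.length_le [v] (by simp) (by simp)

/-- A neighbour on the longest path of a fragment is followed by another vertex. -/
lemma IsFragment.succ_ne_nil (hF : IsFragment G P F) (hP : IsLongestList G P) {A B : List V}
    {x d : V} (hPe : P = A ++ x :: B) (hd : d ∈ F) (hxd : G.Adj x d) : B ≠ [] := by
  rintro rfl
  have hdP := hF.disjoint d hd
  have hc := hP.chain
  have hn := hP.nodup
  have := hP.length_le (P ++ [d])
    (by subst hPe; rw [List.isChain_append]; simp [hc, hxd])
    (by rw [List.nodup_append]; grind)
  simp at this

lemma IsFragment.pred_ne_nil (hF : IsFragment G P F) (hP : IsLongestList G P) {A B : List V}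
    {x d : V} (hPe : P = A ++ x :: B) (hd : d ∈ F) (hxd : G.Adj x d) : A ≠ [] := by
  rintro rfl
  exact hF.reverse.succ_ne_nil hP.reverse (A := B.reverse) (B := []) (by simp [hPe]) hd hxd rfl

/-- Otherwise `d`, `x`, back along `P` to `p`, then `y :: B` is a path with one more vertex. -/
lemma IsFragment.head_not_adj_succ (hF : IsFragment G P F) (hP : IsLongestList G P)
    {A B : List V} {x y d p : V} (hPe : P = A ++ x :: y :: B) (hd : d ∈ F) (hxd : G.Adj x d)
    (hp : P.head? = some p) : ¬ G.Adj p y := by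
  intro hpy
  have hdP := hF.disjoint d hd
  have hc := hP.chain
  have hn := hP.nodup
  subst hPe
  have := hP.length_le (d :: (A ++ [x]).reverse ++ y :: B)
    (by
      rw [List.isChain_append] at hc
      simp only [List.isChain_append, List.isChain_cons, isChain_adj_reverse] at *
      cases A
      · simp_all [G.adj_comm]
      · simp_all [G.adj_comm]
        grind [G.adj_comm])
    (by simp [List.nodup_append, List.nodup_cons] at *; grind)
  simp only [List.length_append, List.length_cons, List.length_nil, List.length_reverse] at this
  omega

/-- Otherwise a detour through `F` fits between `x` and `y`. -/
lemma IsFragment.succ_not_adj (hF : IsFragment G P F) (hP : IsLongestList G P)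
    {A B : List V} {x y d e : V} (hPe : P = A ++ x :: y :: B) (hd : d ∈ F) (hxd : G.Adj x d)
    (he : e ∈ F) : ¬ G.Adj y e := by
  intro hye
  obtain ⟨L, hL, hLn, hLh, hLl, hLF⟩ := hF.connected d hd e he
  have hc := hP.chain
  have hn := hP.nodup
  have hdis := hF.disjoint
  have hLne : L ≠ [] := by rintro rfl; simp at hLh
  subst hPe
  have := hP.length_le ((A ++ [x]) ++ (L ++ y :: B))
    (by
      simp only [List.isChain_append, List.isChain_cons] at *
      cases L <;> simp_all [G.adj_comm])
    (by simp [List.nodup_append, List.nodup_cons] at *; grind)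
  have := List.length_pos_iff.2 hLne
  simp only [List.length_append, List.length_cons, List.length_nil] at *
  omega

/-- Otherwise go from `x` through `F` to `x'`, back along `P` to `y`, and jump to `y'`. -/
lemma IsFragment.succ_not_adj_succ (hF : IsFragment G P F) (hP : IsLongestList G P)
    {A M C : List V} {x y x' y' d e : V} (hPe : P = A ++ x :: y :: (M ++ x' :: y' :: C))
    (hd : d ∈ F) (hxd : G.Adj x d) (he : e ∈ F) (hxe : G.Adj x' e) : ¬ G.Adj y y' := by
  intro hyy
  obtain ⟨L, hL, hLn, hLh, hLl, hLF⟩ := hF.connected d hd e he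
  have hc := hP.chain
  have hn := hP.nodup
  have hdis := hF.disjoint
  have hLne : L ≠ [] := by rintro rfl; simp at hLh
  have hsplit : P = (A ++ [x]) ++ ((y :: (M ++ [x'])) ++ (y' :: C)) := by simp [hPe]
  have hlast : (y :: (M ++ [x'])).getLast? = some x' := by
    rw [← List.cons_append, List.getLast?_concat]
  rw [hsplit, List.isChain_append, List.isChain_append (l₁ := y :: (M ++ [x']))] at hc
  have := hP.length_le ((A ++ [x]) ++ (L ++ ((y :: (M ++ [x'])).reverse ++ (y' :: C))))
    (by
      obtain ⟨h1, ⟨h2, h3, -⟩, -⟩ := hc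
      rw [← isChain_adj_reverse] at h2
      refine List.isChain_append.2 ⟨h1, List.isChain_append.2
        ⟨hL, List.isChain_append.2 ⟨h2, h3, ?_⟩, ?_⟩, ?_⟩
      · rw [List.getLast?_reverse]
        simp [hyy]
      · rw [hLl, List.head?_append, List.head?_reverse, hlast]
        simp [hxe.symm]
      · rw [List.head?_append, hLh]; simp [hxd])
    (by subst hPe; simp [List.nodup_append, List.nodup_cons] at *; grind)
  have := List.length_pos_iff.2 hLne
  simp only [hPe, List.length_append, List.length_cons, List.length_nil, List.length_reverse] at *
  omega

end ListPaths
-- Independent sets built from the attachments of a fragment.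
section Fragments

variable {V : Type*} {G : SimpleGraph V} {P : List V} {F : Finset V}

/-- `y` immediately follows `x` in the list `P`. -/
def IsSucc (P : List V) (x y : V) : Prop := ∃ A B, P = A ++ x :: y :: B

/-- `x` is a vertex of `P` with a neighbour in `F`. -/
def IsAttachment (G : SimpleGraph V) (P : List V) (F : Finset V) (x : V) : Prop :=
  x ∈ P ∧ ∃ d ∈ F, G.Adj x d

lemma IsSucc.order {x y x' y' : V} (h : IsSucc P x y) (h' : IsSucc P x' y') :
    x = x' ∨ x = y' ∨ y = x' ∨ (∃ A M C, P = A ++ x :: y :: (M ++ x' :: y' :: C)) ∨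
      ∃ A M C, P = A ++ x' :: y' :: (M ++ x :: y :: C) := by
  obtain ⟨A, B, rfl⟩ := h
  obtain ⟨A', B', h⟩ := h'
  rcases List.append_eq_append_iff.1 h with ⟨t, rfl, ht⟩ | ⟨t, rfl, ht⟩ <;>
  rcases t with _ | ⟨a, _ | ⟨b, M⟩⟩ <;> simp at ht <;> grind

lemma IsFragment.exists_succ (hF : IsFragment G P F) (hP : IsLongestList G P) {x : V}
    (hx : IsAttachment G P F x) : ∃ y, IsSucc P x y := by
  obtain ⟨hxP, d, hd, hxd⟩ := hx
  obtain ⟨A, B, hPe⟩ := List.append_of_mem hxP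
  rcases B with _ | ⟨y, B⟩
  · exact absurd rfl (hF.succ_ne_nil hP hPe hd hxd)
  · exact ⟨y, A, B, hPe⟩

lemma IsFragment.succ_indep (hF : IsFragment G P F) (hP : IsLongestList G P) {x y x' y' : V}
    (hx : IsAttachment G P F x) (hx' : IsAttachment G P F x') (hne : x ≠ x')
    (h : IsSucc P x y) (h' : IsSucc P x' y') : y ≠ y' ∧ ¬ G.Adj y y' := by
  obtain ⟨-, d, hd, hxd⟩ := hx
  obtain ⟨-, e, he, hxe⟩ := hx'
  have hn := hP.nodup
  rcases h.order h' with h1 | h1 | h1 | ⟨A, M, C, h1⟩ | ⟨A, M, C, h1⟩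
  · exact absurd h1 hne
  -- Consecutive attachments are excluded by `succ_not_adj`.
  · obtain ⟨A, B, hPe⟩ := h'
    exact absurd (h1 ▸ hxd) (hF.succ_not_adj hP hPe he hxe hd)
  · obtain ⟨A, B, hPe⟩ := h
    exact absurd (h1 ▸ hxe) (hF.succ_not_adj hP hPe hd hxd he)
  · refine ⟨?_, hF.succ_not_adj_succ hP h1 hd hxd he hxe⟩
    subst h1; simp [List.nodup_append] at hn; grind
  · refine ⟨?_, fun h => hF.succ_not_adj_succ hP h1 he hxe hd hxd h.symm⟩
    subst h1; simp [List.nodup_append] at hn; grind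

lemma IsFragment.head_succ_indep (hF : IsFragment G P F) (hP : IsLongestList G P) {x y p : V}
    (hx : IsAttachment G P F x) (h : IsSucc P x y) (hp : P.head? = some p) :
    p ≠ y ∧ ¬ G.Adj p y := by
  obtain ⟨-, d, hd, hxd⟩ := hx
  obtain ⟨A, B, hPe⟩ := h
  refine ⟨?_, hF.head_not_adj_succ hP hPe hd hxd hp⟩
  have hn := hP.nodup
  subst hPe
  cases A <;> simp at hp hn <;> grind

lemma IsFragment.succ_mem_indep (hF : IsFragment G P F) (hP : IsLongestList G P) {x y e : V}
    (hx : IsAttachment G P F x) (h : IsSucc P x y) (he : e ∈ F) : e ≠ y ∧ ¬ G.Adj e y := by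
  obtain ⟨-, d, hd, hxd⟩ := hx
  obtain ⟨A, B, hPe⟩ := h
  refine ⟨?_, fun h => hF.succ_not_adj hP hPe hd hxd he h.symm⟩
  rintro rfl
  exact hF.disjoint _ he (by simp [hPe])

lemma IsFragment.head_mem_indep (hF : IsFragment G P F) (hP : IsLongestList G P) {p e : V}
    (he : e ∈ F) (hp : P.head? = some p) : e ≠ p ∧ ¬ G.Adj e p := by
  obtain ⟨t, ht⟩ := List.head?_eq_some_iff.1 hp
  refine ⟨?_, fun h => hF.pred_ne_nil hP (A := []) ht he h.symm rfl⟩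
  rintro rfl
  exact hF.disjoint _ he (by simp [ht])

/-- `G` has no five pairwise distinct and nonadjacent vertices. -/
def NoFiveIndep (G : SimpleGraph V) : Prop :=
  ∀ s : List V, s.Pairwise (fun x y => x ≠ y ∧ ¬ G.Adj x y) → s.length ≤ 4

lemma IsLongestList.exists_head (hP : IsLongestList G P) (v : V) : ∃ p, P.head? = some p := by
  cases P with
  | nil => exact absurd rfl (hP.ne_nil v)
  | cons p t => exact ⟨p, rfl⟩

lemma IsFragment.not_three_attachments (hG : NoFiveIndep G) (hF : IsFragment G P F)
    (hP : IsLongestList G P) {x₁ x₂ x₃ : V} (h₁ : IsAttachment G P F x₁)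
    (h₂ : IsAttachment G P F x₂) (h₃ : IsAttachment G P F x₃) (h₁₂ : x₁ ≠ x₂) (h₁₃ : x₁ ≠ x₃)
    (h₂₃ : x₂ ≠ x₃) : False := by
  obtain ⟨p, hp⟩ := hP.exists_head x₁
  obtain ⟨y₁, s₁⟩ := hF.exists_succ hP h₁
  obtain ⟨y₂, s₂⟩ := hF.exists_succ hP h₂
  obtain ⟨y₃, s₃⟩ := hF.exists_succ hP h₃
  obtain ⟨-, d, hd, -⟩ := id h₁
  have := hG [d, p, y₁, y₂, y₃] (by
    simp [hF.succ_indep hP h₁ h₂ h₁₂ s₁ s₂, hF.succ_indep hP h₁ h₃ h₁₃ s₁ s₃,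
      hF.succ_indep hP h₂ h₃ h₂₃ s₂ s₃, hF.head_succ_indep hP h₁ s₁ hp,
      hF.head_succ_indep hP h₂ s₂ hp, hF.head_succ_indep hP h₃ s₃ hp,
      hF.succ_mem_indep hP h₁ s₁ hd, hF.succ_mem_indep hP h₂ s₂ hd,
      hF.succ_mem_indep hP h₃ s₃ hd, hF.head_mem_indep hP hd hp])
  simp at this

lemma IsFragment.adj_of_two_attachments (hG : NoFiveIndep G) (hF : IsFragment G P F)
    (hP : IsLongestList G P) {x₁ x₂ : V} (h₁ : IsAttachment G P F x₁)
    (h₂ : IsAttachment G P F x₂) (h₁₂ : x₁ ≠ x₂) {d e : V} (hd : d ∈ F) (he : e ∈ F)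
    (hde : d ≠ e) : G.Adj d e := by
  by_contra hadj
  obtain ⟨p, hp⟩ := hP.exists_head x₁
  obtain ⟨y₁, s₁⟩ := hF.exists_succ hP h₁
  obtain ⟨y₂, s₂⟩ := hF.exists_succ hP h₂
  have := hG [d, e, p, y₁, y₂] (by
    simp [hF.succ_indep hP h₁ h₂ h₁₂ s₁ s₂, hF.head_succ_indep hP h₁ s₁ hp,
      hF.head_succ_indep hP h₂ s₂ hp, hF.succ_mem_indep hP h₁ s₁ hd,
      hF.succ_mem_indep hP h₂ s₂ hd, hF.head_mem_indep hP hd hp, hF.succ_mem_indep hP h₁ s₁ he,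
      hF.succ_mem_indep hP h₂ s₂ he, hF.head_mem_indep hP he hp, hde, hadj])
  simp at this

/-- If a fragment is a clique, the part of the path before an attachment is at least as long as
the fragment. -/
lemma IsFragment.card_le_length (hF : IsFragment G P F) (hP : IsLongestList G P)
    (hclique : ∀ d ∈ F, ∀ e ∈ F, d ≠ e → G.Adj d e) {A B : List V} {x d : V}
    (hPe : P = A ++ x :: B) (hd : d ∈ F) (hxd : G.Adj x d) : F.card ≤ B.length := by
  classical
  have hc := hP.chain
  have hn := hP.nodup
  have hdis := hF.disjoint
  have hK : (d :: (F.erase d).toList).IsChain G.Adj := by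
    apply List.Pairwise.isChain
    rw [List.pairwise_cons]
    refine ⟨fun e he => ?_, ?_⟩
    · simp at he
      exact hclique d hd e he.2 (Ne.symm he.1)
    · refine List.Pairwise.imp_of_mem ?_ (F.erase d).nodup_toList
      intro a b ha hb hab
      simp at ha hb
      exact hclique a ha.2 b hb.2 hab
  subst hPe
  -- The tail `B` is exchanged for a Hamiltonian path of the clique `F` starting at `d`.
  have hlen := hP.length_le ((A ++ [x]) ++ d :: (F.erase d).toList)
    (by
      have : A ++ x :: B = (A ++ [x]) ++ B := by simp
      rw [this, List.isChain_append] at hc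
      rw [List.isChain_append]
      exact ⟨hc.1, hK, by simp [hxd]⟩)
    (by
      have := (F.erase d).nodup_toList
      simp [List.nodup_append] at *
      grind)
  have := Finset.card_erase_add_one hd
  simp only [List.length_append, List.length_cons, List.length_nil, Finset.length_toList] at hlen
  omega

end Fragments
-- The extremal argument.
section Main

variable {V : Type*} {G : SimpleGraph V} {P : List V} {F : Finset V}

/-- Two longest paths cannot be disjoint when one lies in a fragment of the other. -/
lemma IsFragment.not_subset (hF : IsFragment G P F) (hP : IsLongestList G P) {Q : List V}
    (hQ : IsLongestList G Q) {a d : V} (ha : a ∈ P) (hd : d ∈ F) (had : G.Adj a d) :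
    ∃ z ∈ Q, z ∉ F := by
  classical
  by_contra! hQF
  obtain ⟨q₀, hq₀⟩ := hQ.exists_head a
  have hq₀Q : q₀ ∈ Q := List.mem_of_mem_head? hq₀
  obtain ⟨L, hL, hLn, hLh, hLl, hLF⟩ := hF.connected d hd q₀ (hQF q₀ hq₀Q)
  obtain ⟨q, L₁, L₂, hLe, hqQ, hL₁⟩ :
      ∃ q L₁ L₂, L = L₁ ++ q :: L₂ ∧ q ∈ Q ∧ ∀ z ∈ L₁, z ∉ Q := by
    have hsome : (L.find? (· ∈ Q)).isSome := by
      rw [List.find?_isSome]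
      exact ⟨q₀, List.mem_of_getLast? hLl, by simpa using hq₀Q⟩
    obtain ⟨q, hq⟩ := Option.isSome_iff_exists.1 hsome
    obtain ⟨h1, L₁, L₂, h2, h3⟩ := List.find?_eq_some_iff_append.1 hq
    exact ⟨q, L₁, L₂, h2, by simpa using h1, by simpa using h3⟩
  obtain ⟨A, B, hPe⟩ := List.append_of_mem ha
  obtain ⟨Q₁, Q₂, hQe⟩ := List.append_of_mem hqQ
  -- Join one end of `P` to one end of `Q` through `L₁`. The two complementary choices together use
  -- all of `P` and `Q`, with `a` and `q` twice, so one choice beats the common length.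
  have key : ∀ A B Q₁ Q₂ : List V, IsLongestList G (A ++ a :: B) →
      IsLongestList G (Q₁ ++ q :: Q₂) → (∀ z ∈ A ++ a :: B, z ∉ F) →
      (∀ z ∈ Q₁ ++ q :: Q₂, z ∈ F) → (∀ z ∈ L₁, z ∉ Q₁ ++ q :: Q₂) →
      A.length + Q₂.length + 2 ≤ P.length := by
    intro A B Q₁ Q₂ h1 h2 hdis hin hL₁
    have hc1 := h1.chain
    have hc2 := h2.chain
    have hn1 := h1.nodup
    have hn2 := h2.nodup
    rw [List.isChain_split] at hc1 hc2
    subst hLe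
    rw [List.isChain_split] at hL
    have := hP.length_le ((A ++ [a]) ++ (L₁ ++ q :: Q₂))
      (by
        refine List.isChain_append.2 ⟨hc1.1, List.isChain_split.2 ⟨hL.1, hc2.2⟩, ?_⟩
        have : (L₁ ++ q :: Q₂).head? = some d := by
          rw [← hLh]; cases L₁ <;> simp
        rw [this]
        simp [had])
      (by
        simp [List.nodup_append] at *
        grind)
    simp only [List.length_append, List.length_cons, List.length_nil] at this
    omega
  have hPF : ∀ z ∈ P, z ∉ F := fun z hz hzF => hF.disjoint z hzF hz
  have e1 := key A B Q₁ Q₂ (hPe ▸ hP) (hQe ▸ hQ) (hPe ▸ hPF) (hQe ▸ hQF) (hQe ▸ hL₁)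
  have hPr : P.reverse = B.reverse ++ a :: A.reverse := by simp [hPe]
  have hQr : Q.reverse = Q₂.reverse ++ q :: Q₁.reverse := by simp [hQe]
  have e2 := key B.reverse A.reverse Q₂.reverse Q₁.reverse (hPr ▸ hP.reverse)
    (hQr ▸ hQ.reverse) (hPr ▸ by simpa using hPF) (hQr ▸ by simpa using hQF)
    (hQr ▸ by simpa using hL₁)
  have h1 := hP.length_le Q hQ.chain hQ.nodup
  have h2 := hQ.length_le P hP.chain hP.nodup
  subst hPe hQe
  simp only [List.length_append, List.length_cons, List.length_reverse] at *
  omega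

/-- Every vertex off a longest path lies in a fragment. -/
lemma exists_fragment [Fintype V] {v : V} (hv : v ∉ P) : ∃ F, IsFragment G P F ∧ v ∈ F := by
  classical
  let H : SimpleGraph V :=
    { Adj := fun x y => G.Adj x y ∧ x ∉ P ∧ y ∉ P
      symm := ⟨fun _ _ h => ⟨h.1.symm, h.2.2, h.2.1⟩⟩
      loopless := ⟨fun _ h => G.irrefl h.1⟩ }
  have hout : ∀ x y, H.Reachable x y → x ∉ P → y ∉ P := by
    rintro x y ⟨p⟩ hx
    induction p with
    | nil => exact hx
    | cons h p ih => exact ih h.2.2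
  refine ⟨Finset.univ.filter fun w => H.Reachable v w, ⟨?_, ?_, ?_⟩, by simp⟩
  · intro x hx
    exact hout v x (by simpa using hx) hv
  · intro x hx y hxy hy
    simp only [Finset.mem_filter, Finset.mem_univ, true_and] at hx ⊢
    have hxP := hout v x hx hv
    exact hx.trans (Adj.reachable (show H.Adj x y from ⟨hxy, hxP, hy⟩))
  · intro x hx y hy
    simp only [Finset.mem_filter, Finset.mem_univ, true_and] at hx hy
    obtain ⟨p, hp⟩ := (hx.symm.trans hy).exists_isPath
    refine ⟨p.support, p.isChain_adj_support.imp fun _ _ h => h.1, hp.support_nodup, ?_, ?_, ?_⟩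
    · rw [List.head?_eq_some_head p.support_ne_nil, p.head_support]
    · rw [List.getLast?_eq_some_getLast p.support_ne_nil, p.getLast_support]
    · intro z hz
      simp only [Finset.mem_filter, Finset.mem_univ, true_and]
      exact hx.trans ⟨p.takeUntil z hz⟩

lemma IsFragment.exists_attachment (hG : G.Connected) (hF : IsFragment G P F)
    (hP : IsLongestList G P) {v : V} (hv : v ∈ F) : ∃ a, IsAttachment G P F a := by
  obtain ⟨p, hp⟩ := hP.exists_head v
  have hpP : p ∈ P := List.mem_of_mem_head? hp
  obtain ⟨w⟩ := hG.preconnected v p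
  obtain ⟨e, -, he1, he2⟩ := w.exists_boundary_dart (F : Set V) hv
    (fun h => hF.disjoint p h hpP)
  refine ⟨e.snd, ?_, e.fst, he1, e.adj.symm⟩
  by_contra h
  exact he2 (hF.closed _ he1 _ e.adj h)

/-- If a fragment `F'` for `Q` meets a set connected by the chain `l` without containing it,
then some vertex of `l` is an attachment of `F'`. -/
lemma IsFragment.exists_attachment_of_chain {Q : List V} {F' : Finset V}
    (hF' : IsFragment G Q F') {l : List V} (hl : l.IsChain G.Adj) {x y : V} (hx : x ∈ l)
    (hy : y ∈ l) (hxF : x ∈ F') (hyF : y ∉ F') :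
    ∃ v ∈ l, IsAttachment G Q F' v := by
  obtain ⟨u, -, v, hv, huF, hvF, huv⟩ := exists_adj_crossing hl (F' : Set V) hx hy hxF hyF
  refine ⟨v, hv, ?_, u, huF, huv.symm⟩
  by_contra h
  exact hvF (hF'.closed u huF v huv h)

theorem exists_mem_all_longestLists [Finite V] (hG : G.Connected) (hα : NoFiveIndep G) :
    ∃ v : V, ∀ P, IsLongestList G P → v ∈ P := by
  classical
  have := Fintype.ofFinite V
  by_contra! hno
  obtain ⟨v₀⟩ := hG.nonempty
  obtain ⟨P₀, hP₀, hv₀⟩ := hno v₀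
  obtain ⟨F₀, hF₀, hvF₀⟩ := exists_fragment (G := G) hv₀
  obtain ⟨F, hFmem, hmax⟩ := Finset.exists_max_image
    -- Nonemptiness is demanded because the empty set satisfies `IsFragment`.
    (Finset.univ.filter fun F : Finset V => F.Nonempty ∧ ∃ P, IsLongestList G P ∧ IsFragment G P F)
    Finset.card ⟨F₀, by simpa using ⟨⟨v₀, hvF₀⟩, P₀, hP₀, hF₀⟩⟩
  simp only [Finset.mem_filter, Finset.mem_univ, true_and] at hFmem hmax
  obtain ⟨⟨v, hv⟩, P, hP, hF⟩ := hFmem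
  obtain ⟨a, ha⟩ := hF.exists_attachment hG hP hv
  obtain ⟨haP, d, hd, had⟩ := id ha
  obtain ⟨Q, hQ, haQ⟩ := hno a
  obtain ⟨F', hF', haF'⟩ := exists_fragment (G := G) haQ
  have hcard : F'.card ≤ F.card := hmax F' ⟨⟨a, haF'⟩, Q, hQ, hF'⟩
  have haF : a ∉ F := fun h => hF.disjoint a h haP
  obtain ⟨u, huF, hu⟩ : ∃ u ∈ F, IsAttachment G Q F' u := by
    obtain ⟨y, hyF, hyF'⟩ : ∃ y ∈ F, y ∉ F' := by
      by_contra! h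
      have : insert a F ⊆ F' := Finset.insert_subset haF' h
      have := Finset.card_le_card this
      rw [Finset.card_insert_of_notMem haF] at this
      omega
    obtain ⟨L, hL, -, hLh, hLl, hLF⟩ := hF.connected d hd y hyF
    obtain ⟨u, hu, hua⟩ := hF'.exists_attachment_of_chain (l := a :: L) (x := a) (y := y)
      (by rw [List.isChain_cons]; exact ⟨by simp [hLh, had], hL⟩) (by simp)
      (List.mem_cons_of_mem _ (List.mem_of_getLast? hLl)) haF' hyF'
    refine ⟨u, ?_, hua⟩
    rcases List.mem_cons.1 hu with rfl | hu
    · exact absurd hua.1 haQ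
    · exact hLF u hu
  by_cases hb : ∃ b, b ≠ a ∧ IsAttachment G P F b
  · obtain ⟨b, hba, hb⟩ := hb
    have hclique : ∀ d ∈ F, ∀ e ∈ F, d ≠ e → G.Adj d e := fun d hd e he hde =>
      hF.adj_of_two_attachments hα hP hb ha hba hd he hde
    -- Stated for any `P` so that it also applies to the reversed path, giving the other side of
    -- `a`.
    have side : ∀ P A B : List V, IsLongestList G P → IsFragment G P F → P = A ++ a :: B →
        ∃ x ∈ B, IsAttachment G Q F' x := by
      intro P A B hP hF hPe
      have hlen := hF.card_le_length hP hclique hPe hd had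
      have hn := hP.nodup
      have hc := hP.chain
      rw [hPe, List.isChain_split] at hc
      have hnB : (a :: B).Nodup := (List.nodup_append.1 (hPe ▸ hn)).2.1
      obtain ⟨y, hyB, hyF'⟩ : ∃ y ∈ a :: B, y ∉ F' := by
        by_contra! h
        have h1 : (a :: B).toFinset ⊆ F' := fun z hz => h z (by simpa using hz)
        have h2 := Finset.card_le_card h1
        rw [List.toFinset_card_of_nodup hnB, List.length_cons] at h2
        omega
      obtain ⟨x, hx, hxa⟩ := hF'.exists_attachment_of_chain hc.2 (x := a) (by simp) hyB haF' hyF'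
      refine ⟨x, ?_, hxa⟩
      rcases List.mem_cons.1 hx with rfl | hx
      · exact absurd hxa.1 haQ
      · exact hx
    obtain ⟨A, B, hPe⟩ := List.append_of_mem haP
    obtain ⟨x, hxB, hx⟩ := side P A B hP hF hPe
    obtain ⟨y, hyA, hy⟩ := side P.reverse B.reverse A.reverse hP.reverse hF.reverse
      (by simp [hPe])
    have hn := hP.nodup
    have hdis := hF.disjoint u huF
    subst hPe
    refine hF'.not_three_attachments hα hQ hu hx hy ?_ ?_ ?_
    · rintro rfl; simp [hxB] at hdis
    · rintro rfl; simp at hyA; simp [hyA] at hdis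
    · rintro rfl; simp [List.nodup_append] at hn hyA; grind
  · push Not at hb
    obtain ⟨z, hzQ, hzF⟩ := hF.not_subset hP hQ haP hd had
    obtain ⟨x, hx, hxa⟩ := hF.exists_attachment_of_chain hQ.chain hu.1 hzQ huF hzF
    by_cases h : x = a
    · exact haQ (h ▸ hx)
    · exact hb x h hxa

end Main

/-! ### Transfer to walks, `indepNum` and `lpt`. -/

section Walks

variable {V : Type*} {G : SimpleGraph V}

lemma IsLongestPath.isLongestList {a b : V} {p : G.Walk a b} (hp : IsLongestPath G p) :
    IsLongestList G p.support := by
  refine ⟨p.isChain_adj_support, hp.1.support_nodup, fun l hl hn => ?_⟩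
  by_cases hne : l = []
  · simp [hne]
  · have := hp.2 _ _ (Walk.ofSupport l hne hl)
      ((Walk.isPath_def _).2 (by rwa [Walk.support_ofSupport]))
    rw [Walk.length_ofSupport] at this
    rw [Walk.length_support]
    omega

lemma noFiveIndep_of_indepNum_le [Finite V] (h : G.indepNum ≤ 4) : NoFiveIndep G := by
  classical
  have := Fintype.ofFinite V
  intro s hs
  have hn : s.Nodup := hs.imp fun h => h.1
  have hind : G.IsIndepSet (s.toFinset : Set V) := by
    intro x hx y hy hxy
    simp only [List.coe_toFinset, Set.mem_ofPred_eq] at hx hy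
    have : Std.Symm fun x y => x ≠ y ∧ ¬ G.Adj x y :=
      ⟨fun x y h => ⟨h.1.symm, fun hadj => h.2 hadj.symm⟩⟩
    exact (hs.forall hx hy hxy).2
  have := hind.card_le_indepNum
  rw [List.toFinset_card_of_nodup hn] at this
  omega

theorem exists_isGallaiVertex [Finite V] (hG : G.Connected) (h : G.indepNum ≤ 4) :
    ∃ v : V, IsGallaiVertex G v := by
  obtain ⟨v, hv⟩ := exists_mem_all_longestLists hG (noFiveIndep_of_indepNum_le h)
  exact ⟨v, fun a b p hp => ⟨v, rfl, hv _ hp.isLongestList⟩⟩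

/-- Needed so that the empty set is not a Gallai set, which would make `lpt` zero. -/
lemma exists_isLongestPath [Finite V] [Nonempty V] (G : SimpleGraph V) :
    ∃ (a b : V) (p : G.Walk a b), IsLongestPath G p := by
  classical
  have := Fintype.ofFinite V
  let S : Set ℕ := {n | ∃ (a b : V) (p : G.Walk a b), p.IsPath ∧ p.length = n}
  have hfin : S.Finite := (Set.finite_lt_nat (Fintype.card V)).subset (by
    rintro n ⟨a, b, p, hp, rfl⟩
    exact hp.length_lt)
  obtain ⟨v⟩ := ‹Nonempty V›
  obtain ⟨n, ⟨a, b, p, hp, rfl⟩, hmax⟩ :=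
    Set.exists_max_image S id hfin ⟨0, v, v, Walk.nil, Walk.IsPath.nil, rfl⟩
  exact ⟨a, b, p, hp, fun c d q hq => hmax _ ⟨c, d, q, hq, rfl⟩⟩

lemma IsGallaiVertex.lpt_eq_one [Finite V] {v : V} (hv : IsGallaiVertex G v) : lpt G = 1 := by
  have : Nonempty V := ⟨v⟩
  obtain ⟨a, b, p, hp⟩ := exists_isLongestPath G
  have h1 : 1 ∈ {n : ℕ | ∃ S : Finset V, S.card = n ∧ IsGallaiSet G (S : Set V)} :=
    ⟨{v}, by simp, by simpa [IsGallaiVertex] using hv⟩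
  refine le_antisymm (Nat.sInf_le h1) (Nat.one_le_iff_ne_zero.2 fun h0 => ?_)
  have := Nat.sInf_mem ⟨1, h1⟩
  rw [← lpt, h0] at this
  obtain ⟨S, hS, hS'⟩ := this
  rw [Finset.card_eq_zero] at hS
  subst hS
  simpa using hS' a b p hp

lemma indepNum_le_of_freeClass [Finite V] {k : ℕ}
    (h : FreeClass (copies (k + 1) (pathGraph 1)) V G) : G.indepNum ≤ k := by
  classical
  have := Fintype.ofFinite V
  by_contra! hlt
  obtain ⟨s, hs⟩ := G.exists_isNIndepSet_indepNum
  obtain ⟨t, hts, ht⟩ := Finset.exists_subset_card_eq (s := s) (n := k + 1)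
    (by rw [hs.card_eq]; omega)
  let e := t.equivFinOfCardEq ht
  have hadj : ∀ i j, ¬ G.Adj (e.symm i : V) (e.symm j) := fun i j hij =>
    hs.isIndepSet (hts (e.symm i).2) (hts (e.symm j).2) hij.ne hij
  refine h ⟨⟨⟨fun x => e.symm x.1, ?_⟩, ?_⟩⟩
  · rintro ⟨i, x⟩ ⟨j, y⟩ hij
    simp at hij
    exact Prod.ext hij (Subsingleton.elim _ _)
  · rintro ⟨i, x⟩ ⟨j, y⟩
    refine ⟨fun h => absurd h (hadj i j), fun h => ?_⟩
    exact absurd (Subsingleton.elim x y) h.2.ne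

end Walks
end GallaiPaths

theorem theorem20 :
    (∀ (V : Type u) [Finite V] (G : SimpleGraph V), G.Connected → G.indepNum ≤ 4 →
      ∃ v : V, GallaiPaths.IsGallaiVertex G v) ∧
    GallaiPaths.IsFixer.{u} (GallaiPaths.copies 5 (SimpleGraph.pathGraph 1)) := by
  refine ⟨fun V _ G hG h => GallaiPaths.exists_isGallaiVertex hG h, fun V _ G hfree hG => ?_⟩
  obtain ⟨v, hv⟩ := GallaiPaths.exists_isGallaiVertex hG
    (GallaiPaths.indepNum_le_of_freeClass hfree)
  exact hv.lpt_eq_one
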